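/- Let $F\neq\mathbb Q$ be a number field of degree $d$, with ring of integers $\mathcal O_F$, discriminant $D_F$ and set $\Sigma$ of field embeddings $\sigma:F\to\mathbb C$. Put $F_{\mathbb R}=\mathbb R\otimes_{\mathbb Q}F$, and for $x\in F_{\mathbb R}$ let $x_\sigma\in\mathbb C$ be its component at $\sigma\in\Sigma$, so that $(r\otimes a)_\sigma=r\,\sigma(a)$. Let $L$ be a free $\mathcal O_F$-module of finite rank $N\ge 5$, $V=F\otimes_{\mathcal O_F}L$ and $V_{\mathbb R}=\mathbb R\otimes_{\mathbb Q}V=F_{\mathbb R}\otimes_F V$, and let $\Gamma=\mathrm{GL}(L)\cong\mathrm{GL}_N(\mathcal O_F)$ be the group of $\mathcal O_F$-linear automorphisms of $L$. A hermitian form on $V_{\mathbb R}$ is a map $h:V_{\mathbb R}\times V_{\mathbb R}\to F_{\mathbb R}$ that is $F_{\mathbb R}$-linear in the first variable and satisfies $h(y,x)_\sigma=\overline{h(x,y)_\sigma}$ for all $x,y\in V_{\mathbb R}$, $\sigma\in\Sigma$. It is positive definite if for every nonzero $x\in V_{\mathbb R}$ all the real numbers $h(x,x)_\sigma$ $(\sigma\in\Sigma)$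 are nonnegative and at least one of them is positive. For such $h$ let $q_h(x)=\sum_{\sigma\in\Sigma}h(x,x)_\sigma$, let $m(L,h)$ be the minimum of $q_h(x)$ over the nonzero $x\in L$, and let $M(L,h)=\{x\in L : q_h(x)=m(L,h)\}$. One says that $h$ is well rounded if $m(L,h)=1$ and $M(L,h)$ spans $V$ over $F$. Then there is a finite set $\Phi\subset L$ with $$\mathrm{card}(\Phi)\le N^{3N^2d^2}\cdot d^{5N^3d^4}\cdot|D_F|^{9N^3d^3}$$ such that for every well-rounded positive definite hermitian form $h$ on $V_{\mathbb R}$ there exists $\gamma\in\Gamma$ with $\gamma M(L,h)\subset\Phi$. -/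

import Mathlib

open scoped TensorProduct NumberField

noncomputable section

namespace HermitianLattice

/-- `F_ℝ`, the real étale algebra `F ⊗ ℝ` over `ℚ`. -/
abbrev FR (F : Type*) [Field F] [NumberField F] : Type _ := F ⊗[ℚ] ℝ

/-- The component `x ↦ x_σ` of `F_ℝ` at a field embedding `σ : F → ℂ`,
characterized by `(a ⊗ r)_σ = σ(a) r`. -/
def comp {F : Type*} [Field F] [NumberField F] (σ : F →+* ℂ) : FR F →ₐ[ℚ] ℂ :=
  Algebra.TensorProduct.productMap σ.toRatAlgHom Complex.ofRealHom.toRatAlgHom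

/-- The `F`-vector space `V = F ⊗ L` spanned by the lattice `L`. -/
abbrev V (F : Type*) [Field F] [NumberField F] (L : Type*) [AddCommGroup L] [Module (𝓞 F) L] :
    Type _ := F ⊗[𝓞 F] L

/-- The `F_ℝ`-module `V_ℝ = F_ℝ ⊗_F V` (which is `ℝ ⊗_ℚ V`). -/
abbrev VR (F : Type*) [Field F] [NumberField F] (L : Type*) [AddCommGroup L] [Module (𝓞 F) L] :
    Type _ := FR F ⊗[F] V F L

variable (F : Type*) [Field F] [NumberField F] (L : Type*) [AddCommGroup L] [Module (𝓞 F) L]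

/-- The inclusion of `L` in `V`. -/
def toV (x : L) : V F L := (1 : F) ⊗ₜ[𝓞 F] x

/-- The inclusion of `L` in `V_ℝ`. -/
def toVR (x : L) : VR F L := (1 : FR F) ⊗ₜ[F] toV F L x

/-- The space `X` of positive definite hermitian forms `h : V_ℝ × V_ℝ → F_ℝ`:
`h` is `F_ℝ`-linear in the first variable, `h(y,x)` is the componentwise complex conjugate of
`h(x,y)`, and every component `h_σ` is positive definite. As `F_ℝ` is a product of fields and
`h_σ(x,x)` only depends on the `σ`-component of `x`, the last condition says that all components of
`h(x,x)` are nonnegative, and that they do not all vanish when `x ≠ 0`. -/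
structure PosDefHermitianForm where
  /-- The form itself. -/
  form : VR F L → VR F L → FR F
  add_left : ∀ x y z, form (x + y) z = form x z + form y z
  smul_left : ∀ (a : FR F) (x y : VR F L), form (a • x) y = a * form x y
  conj_symm : ∀ (x y : VR F L) (σ : F →+* ℂ),
    comp σ (form y x) = (starRingEnd ℂ) (comp σ (form x y))
  nonneg : ∀ (x : VR F L) (σ : F →+* ℂ), 0 ≤ (comp σ (form x x)).re
  pos : ∀ x : VR F L, x ≠ 0 → ∃ σ : F →+* ℂ, 0 < (comp σ (form x x)).re

namespace PosDefHermitianForm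

variable {F L}
variable (h : PosDefHermitianForm F L)

/-- The hermitian metric `q_h(x) = Tr(h(x,x))`, where `Tr` is the sum of the components
(all components of `h(x,x)` are real). -/
def q (x : VR F L) : ℝ := ∑ σ : F →+* ℂ, (comp σ (h.form x x)).re

/-- `m(L,h)`, the minimum of `q_h` over the nonzero vectors of `L`. -/
def m : ℝ := sInf {r : ℝ | ∃ x : L, x ≠ 0 ∧ h.q (toVR F L x) = r}

/-- `M(L,h)`, the set of minimal vectors of `L`. -/
def M : Set L := {x : L | h.q (toVR F L x) = h.m}

/-- `h` is well rounded if `m(L,h) = 1` and `M(L,h)` spans `V` over `F`. -/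
def IsWellRounded : Prop :=
  h.m = 1 ∧ Submodule.span F (toV F L '' h.M) = ⊤

end PosDefHermitianForm

end HermitianLattice

end

/-! ### Minkowski's bound for quadratic forms -/

/-! Write n = N d and Q = n ^ n |D_F| ^ N. Fix an 𝓞 F-basis f of L. For a well-rounded h, choose an
F-basis e of V among the minimal vectors and let T be the endomorphism of L with T (f i) = e i, and
E its integer matrix in the ℤ-basis attached to f.

Two estimates control T. Minkowski's theorem bounds the determinant of the trace form on L below by
n ^ (-n), because the minimum is 1. Since q_h(e i) = 1, AM-GM on eigenvalues bounds each Gram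
determinant G_σ of e above by 1. The identity (det E)² · det(trace form) = |D_F| ^ N ∏ G_σ then
yields (det E)² ≤ Q and G_σ ≥ 1 / Q for every σ.

Let x be minimal and δ = |det E|, so that δ x = T y for some y in L. Cramer's rule for Gram
determinants gives |σ(y_i)|² G_σ ≤ δ², so |σ(y_i)| ≤ Q. Hence x lies in a finite set depending only
on T, with at most (4Q + 1) ^ (2n) elements.

Up to Γ, T depends only on the row lattice of E: equal row lattices mean that T' = γ T with γ in Γ.
This lattice has index at most √Q in ℤ ^ n, which leaves at most Q ^ n possibilities. One finite set
for each of these lattices suffices, so the total is at most Q ^ n (4Q + 1) ^ (2n). -/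

open MeasureTheory Matrix in
open scoped MatrixOrder Matrix.Norms.L2Operator in
theorem Matrix.PosDef.one_le_det_mul_card_pow {ι : Type*} [Fintype ι] [DecidableEq ι]
    {A : Matrix ι ι ℝ} (hA : A.PosDef)
    (h : ∀ x : ι → ℤ, x ≠ 0 → 1 ≤ (fun i ↦ (x i : ℝ)) ⬝ᵥ A *ᵥ (fun i ↦ (x i : ℝ))) :
    1 ≤ A.det * (Fintype.card ι : ℝ) ^ Fintype.card ι := by
  rcases isEmpty_or_nonempty ι with hι | hι
  · simp
  by_contra! hlt
  obtain ⟨B, hB⟩ := CStarAlgebra.nonneg_iff_eq_star_mul_self.mp hA.posSemidef.nonneg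
  have hAB : A = Bᵀ * B := by simpa [star_eq_conjTranspose] using hB
  have hdet : A.det = B.det ^ 2 := by rw [hAB, det_mul, det_transpose, sq]
  have hB0 : B.det ≠ 0 := fun h0 ↦ hA.det_pos.ne' (by rw [hdet, h0]; simp)
  have hn : (0 : ℝ) < Fintype.card ι := by exact_mod_cast Fintype.card_pos
  -- The open cube of half-side 1/√n lies in the unit ball. Using it in place of the ball gives the
  -- constant n ^ n.
  set r : ℝ := (Real.sqrt (Fintype.card ι))⁻¹ with hr
  have hr0 : 0 < r := by positivity
  have hr2 : r ^ 2 = (Fintype.card ι : ℝ)⁻¹ := by rw [hr, inv_pow, Real.sq_sqrt hn.le]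
  let f : (ι → ℝ) →ₗ[ℝ] (ι → ℝ) := Matrix.toLin' B
  have hf : LinearMap.det f = B.det := LinearMap.det_toLin' B
  let s : Set (ι → ℝ) := f ⁻¹' Set.pi Set.univ fun _ ↦ Set.Ioo (-r) r
  have hsymm : ∀ x ∈ s, -x ∈ s := by
    intro x hx i hi
    have := hx i hi
    simp only [map_neg, Pi.neg_apply, Set.mem_Ioo] at this ⊢
    constructor <;> linarith [this.1, this.2]
  have hconv : Convex ℝ s := (convex_pi fun i _ ↦ convex_Ioo _ _).linear_preimage f
  have hvol : volume (ZSpan.fundamentalDomain (Pi.basisFun ℝ ι)) * 2 ^ Module.finrank ℝ (ι → ℝ)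
      < volume s := by
    rw [Measure.addHaar_preimage_linearMap volume (by rwa [hf]), hf, Real.volume_pi_Ioo,
      ZSpan.fundamentalDomain_pi_basisFun, volume_pi, Measure.pi_pi]
    have hpos : 0 < |B.det| := abs_pos.mpr hB0
    have hlt' : |B.det| < r ^ Fintype.card ι := by
      refine lt_of_pow_lt_pow_left₀ 2 (by positivity) ?_
      rw [sq_abs, ← hdet, ← pow_mul, mul_comm, pow_mul, hr2, inv_pow]
      rwa [lt_inv_comm₀ hA.det_pos (by positivity), ← one_div,
        lt_div_iff₀ hA.det_pos, mul_comm]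
    simp only [Real.volume_Ico, sub_zero, ENNReal.ofReal_one, Finset.prod_const_one, one_mul,
      sub_neg_eq_add, Finset.prod_const, Finset.card_univ, Module.finrank_fintype_fun_eq_card]
    rw [← ENNReal.ofReal_pow (by positivity), ← ENNReal.ofReal_mul (by positivity),
      show (2 : ENNReal) = ENNReal.ofReal 2 by simp, ← ENNReal.ofReal_pow (by positivity)]
    refine (ENNReal.ofReal_lt_ofReal_iff (by positivity)).mpr ?_
    rw [← two_mul, mul_pow, abs_inv, inv_mul_eq_div, lt_div_iff₀ hpos]
    exact mul_lt_mul_of_pos_left hlt' (by positivity)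
  have : Countable (Submodule.span ℤ (Set.range (Pi.basisFun ℝ ι))).toAddSubgroup :=
    inferInstanceAs (Countable (Submodule.span ℤ (Set.range (Pi.basisFun ℝ ι))))
  obtain ⟨x, hx0, hxs⟩ := exists_ne_zero_mem_lattice_of_measure_mul_two_pow_lt_measure
    (ZSpan.isAddFundamentalDomain' (Pi.basisFun ℝ ι) volume) hsymm hconv hvol
  have hxint : ∀ i, ∃ c : ℤ, (c : ℝ) = (x : ι → ℝ) i := by
    have := ((Pi.basisFun ℝ ι).mem_span_iff_repr_mem ℤ (x : ι → ℝ)).mp x.2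
    simpa using this
  choose c hc using hxint
  have hcx : (fun i ↦ (c i : ℝ)) = (x : ι → ℝ) := funext hc
  have hc0 : c ≠ 0 := by
    rintro rfl
    exact hx0 (Subtype.ext (by rw [← hcx]; ext; simp))
  have h1 := h c hc0
  rw [hcx, hAB, ← mulVec_mulVec, dotProduct_mulVec, vecMul_transpose] at h1
  have h2 : (B *ᵥ (x : ι → ℝ)) ⬝ᵥ (B *ᵥ (x : ι → ℝ)) < ∑ _i : ι, r ^ 2 := by
    refine Finset.sum_lt_sum_of_nonempty Finset.univ_nonempty fun i _ ↦ ?_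
    have := hxs i (Set.mem_univ i)
    rw [← sq]
    exact sq_lt_sq' this.1 this.2
  simp only [Finset.sum_const, Finset.card_univ, nsmul_eq_mul, hr2] at h2
  rw [mul_inv_cancel₀ hn.ne'] at h2
  exact absurd h2 (not_lt.mpr h1)

open Matrix Filter Topology in
-- Adding ε times the identity makes the form definite and only increases its values; then ε tends
-- to 0.
theorem Matrix.PosSemidef.one_le_det_mul_card_pow {ι : Type*} [Fintype ι] [DecidableEq ι]
    {A : Matrix ι ι ℝ} (hA : A.PosSemidef)
    (h : ∀ x : ι → ℤ, x ≠ 0 → 1 ≤ (fun i ↦ (x i : ℝ)) ⬝ᵥ A *ᵥ (fun i ↦ (x i : ℝ))) :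
    1 ≤ A.det * (Fintype.card ι : ℝ) ^ Fintype.card ι := by
  have hcont : Continuous fun ε : ℝ ↦
      (A + ε • (1 : Matrix ι ι ℝ)).det * (Fintype.card ι : ℝ) ^ Fintype.card ι :=
    (Continuous.matrix_det (by fun_prop)).mul continuous_const
  have hlim := (hcont.tendsto 0).mono_left (nhdsWithin_le_nhds (s := Set.Ioi 0))
  simp only [zero_smul, add_zero] at hlim
  refine ge_of_tendsto hlim ?_
  filter_upwards [self_mem_nhdsWithin] with ε hε
  have hε' : (ε • (1 : Matrix ι ι ℝ)).PosDef := PosDef.one.smul hε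
  refine (hε'.posSemidef_add hA).one_le_det_mul_card_pow fun x hx ↦ ?_
  rw [add_mulVec, dotProduct_add]
  have := hε'.posSemidef.dotProduct_mulVec_nonneg (fun i ↦ (x i : ℝ))
  simp only [star_trivial] at this
  linarith [h x hx]

/-! ### A determinant bound -/

open scoped ComplexOrder in
-- By AM-GM on the eigenvalues, the determinant is at most (trace / n) ^ n, and the trace is at most
-- n.
theorem Matrix.PosSemidef.re_det_le_one {ι : Type*} [Fintype ι] [DecidableEq ι]
    {A : Matrix ι ι ℂ} (hA : A.PosSemidef) (h : ∀ i, (A i i).re ≤ 1) : A.det.re ≤ 1 := by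
  rcases isEmpty_or_nonempty ι with hι | hι
  · simp
  have hn : (0 : ℝ) < Fintype.card ι := by exact_mod_cast Fintype.card_pos
  have hdet : A.det.re = ∏ i, hA.1.eigenvalues i := by
    rw [hA.1.det_eq_prod_eigenvalues, ← Complex.ofReal_re (∏ i, hA.1.eigenvalues i)]
    push_cast
    rfl
  have htr : ∑ i, hA.1.eigenvalues i ≤ Fintype.card ι := by
    have h1 : A.trace.re = ∑ i, hA.1.eigenvalues i := by
      rw [hA.1.trace_eq_sum_eigenvalues]
      simp
    rw [← h1, Matrix.trace, Complex.re_sum]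
    calc _ ≤ ∑ _i : ι, (1 : ℝ) := Finset.sum_le_sum fun i _ ↦ h i
      _ = _ := by simp
  have amgm := Real.geom_mean_le_arith_mean Finset.univ (fun _ : ι ↦ (1 : ℝ)) hA.1.eigenvalues
    (fun _ _ ↦ zero_le_one) (by simpa using hn) (fun i _ ↦ hA.eigenvalues_nonneg i)
  simp only [Real.rpow_one, Finset.sum_const, Finset.card_univ, nsmul_eq_mul, mul_one,
    one_mul] at amgm
  rw [hdet]
  have hp : 0 ≤ ∏ i, hA.1.eigenvalues i := Finset.prod_nonneg fun i _ ↦ hA.eigenvalues_nonneg i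
  have hle := amgm.trans ((div_le_one hn).mpr htr)
  by_contra! hgt
  exact absurd hle (not_le.mpr (Real.one_lt_rpow hgt (inv_pos.mpr hn)))

/-! ### Counting subgroups of finite index -/

theorem AddSubgroup.index_dvd_of_mem_int {H : AddSubgroup ℤ} {x : ℤ} (hx : x ∈ H) :
    (H.index : ℤ) ∣ x := by
  obtain ⟨a, rfl⟩ := Int.subgroup_cyclic H
  rw [← AddSubgroup.zmultiples_eq_closure] at hx ⊢
  rw [Int.index_zmultiples, Int.natAbs_dvd]
  exact Int.mem_zmultiples_iff.mp hx

theorem AddSubgroup.index_mem_int (H : AddSubgroup ℤ) : (H.index : ℤ) ∈ H := by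
  simpa using H.nsmul_index_mem 1

/-- The subgroups of an additive group of positive index at most `B`. -/
def boundedIndexSubgroups (A : Type*) [AddCommGroup A] (B : ℕ) : Set (AddSubgroup A) :=
  {K | K.index ≠ 0 ∧ K.index ≤ B}

/-- A subgroup K of ℤ ^ (n + 1) is determined by its intersection with the kernel of the first
coordinate, the positive generator of its projection to ℤ, and a lift of that generator modulo the
intersection. The last two have at most B choices each, so each step of the induction costs a factor
B ^ 2. -/
theorem boundedIndexSubgroups_fin_finite_card (n B : ℕ) :
    Finite (boundedIndexSubgroups (Fin n → ℤ) B) ∧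
      Nat.card (boundedIndexSubgroups (Fin n → ℤ) B) ≤ (B ^ 2) ^ n := by
  induction n with
  | zero =>
    have : Subsingleton (AddSubgroup (Fin 0 → ℤ)) :=
      ⟨fun a b ↦ AddSubgroup.ext fun x ↦ by
        rw [Subsingleton.elim x 0]
        exact iff_of_true a.zero_mem b.zero_mem⟩
    exact ⟨inferInstance, by
      rw [pow_zero]
      exact Finite.card_le_one_iff_subsingleton.mpr inferInstance⟩
  | succ n ih =>
    obtain ⟨hfin, hcard⟩ := ih
    let i : (Fin n → ℤ) →+ (Fin (n + 1) → ℤ) :=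
      { toFun := fun v ↦ Fin.cons 0 v
        map_zero' := by ext j; cases j using Fin.cases <;> simp
        map_add' := fun v w ↦ by ext j; cases j using Fin.cases <;> simp }
    have hi : ∀ x : Fin (n + 1) → ℤ, x 0 = 0 → i (Fin.tail x) = x := fun x hx ↦ by
      change Fin.cons 0 (Fin.tail x) = x
      rw [← hx, Fin.cons_self_tail]
    let p : (Fin (n + 1) → ℤ) →+ ℤ := Pi.evalAddMonoidHom _ 0
    have hp : Function.Surjective p := fun a ↦ ⟨fun _ ↦ a, rfl⟩
    have hmem : ∀ K : boundedIndexSubgroups (Fin (n + 1) → ℤ) B,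
        K.1.comap i ∈ boundedIndexSubgroups (Fin n → ℤ) B := fun K ↦ by
      have hd : (K.1.comap i).index ∣ K.1.index := by
        rw [AddSubgroup.index_comap]
        exact AddSubgroup.relIndex_dvd_index_of_normal _ _
      exact ⟨fun h0 ↦ K.2.1 (Nat.eq_zero_of_zero_dvd (h0 ▸ hd)),
        (Nat.le_of_dvd (Nat.pos_of_ne_zero K.2.1) hd).trans K.2.2⟩
    have hidx : ∀ K : boundedIndexSubgroups (Fin (n + 1) → ℤ) B,
        (K.1.map p).index ≠ 0 ∧ (K.1.map p).index ≤ B := fun K ↦ by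
      have hd := K.1.index_map_dvd hp
      exact ⟨fun h0 ↦ K.2.1 (Nat.eq_zero_of_zero_dvd (h0 ▸ hd)),
        (Nat.le_of_dvd (Nat.pos_of_ne_zero K.2.1) hd).trans K.2.2⟩
    have hex : ∀ K : boundedIndexSubgroups (Fin (n + 1) → ℤ) B, ∃ k ∈ K.1, k 0 = ((K.1.map p).index : ℤ) :=
      fun K ↦ AddSubgroup.mem_map.mp (K.1.map p).index_mem_int
    choose k hkK hk0 using hex
    have henc : ∀ K' : boundedIndexSubgroups (Fin n → ℤ) B, ∃ c : (Fin n → ℤ) → Fin B,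
        ∀ v w, c v = c w → v - w ∈ K'.1 := fun K' ↦ by
      have : K'.1.FiniteIndex := ⟨K'.2.1⟩
      have : Fintype ((Fin n → ℤ) ⧸ K'.1) := Fintype.ofFinite _
      have hle : Fintype.card ((Fin n → ℤ) ⧸ K'.1) ≤ Fintype.card (Fin B) := by
        rw [← Nat.card_eq_fintype_card, Fintype.card_fin]
        exact K'.2.2
      obtain ⟨c⟩ := Function.Embedding.nonempty_of_card_le hle
      refine ⟨fun v ↦ c (QuotientAddGroup.mk v), fun v w hvw ↦ ?_⟩
      have := QuotientAddGroup.eq.mp (c.injective hvw).symm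
      rwa [neg_add_eq_sub] at this
    choose c hc using henc
    -- The index of the projection lies between 1 and B, hence the shift by 1 to land in `Fin B`.
    let g : boundedIndexSubgroups (Fin (n + 1) → ℤ) B → boundedIndexSubgroups (Fin n → ℤ) B × Fin B × Fin B := fun K ↦
      ⟨⟨K.1.comap i, hmem K⟩, ⟨(K.1.map p).index - 1, by have := hidx K; omega⟩,
        c ⟨K.1.comap i, hmem K⟩ (Fin.tail (k K))⟩
    have key : ∀ K₁ K₂ : boundedIndexSubgroups (Fin (n + 1) → ℤ) B, g K₁ = g K₂ → K₁.1 ≤ K₂.1 := by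
      intro K₁ K₂ hg x hx
      simp only [g, Prod.mk.injEq, Fin.mk.injEq] at hg
      obtain ⟨hK, hind, hcc⟩ := hg
      rw [hK] at hcc
      have hKK : K₁.1.comap i = K₂.1.comap i := congrArg Subtype.val hK
      have hind' : (K₁.1.map p).index = (K₂.1.map p).index := by
        have h₁ := hidx K₁
        have h₂ := hidx K₂
        omega
      have hkk : k K₁ - k K₂ ∈ K₂.1 := by
        have := hi (k K₁ - k K₂) (by simp [hk0, hind'])
        rw [← this]
        exact hc _ _ _ hcc
      have hk₁ : k K₁ ∈ K₂.1 := by simpa using K₂.1.add_mem hkk (hkK K₂)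
      obtain ⟨t, ht⟩ := AddSubgroup.index_dvd_of_mem_int
        (AddSubgroup.mem_map_of_mem p hx : p x ∈ K₁.1.map p)
      have hy : x - t • k K₁ ∈ K₁.1 := K₁.1.sub_mem hx (K₁.1.zsmul_mem (hkK K₁) t)
      have hy0 : (x - t • k K₁) 0 = 0 := by
        have ht' : x 0 = ((K₁.1.map p).index : ℤ) * t := ht
        simp [hk0, ht', mul_comm]
      have hy' : x - t • k K₁ ∈ K₂.1 := by
        rw [← hi _ hy0] at hy ⊢
        have : Fin.tail (x - t • k K₁) ∈ K₁.1.comap i := hy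
        rw [hKK] at this
        exact this
      simpa using K₂.1.add_mem hy' (K₂.1.zsmul_mem hk₁ t)
    have hinj : Function.Injective g := fun K₁ K₂ hg ↦
      Subtype.ext (le_antisymm (key _ _ hg) (key _ _ hg.symm))
    refine ⟨Finite.of_injective g hinj, (Nat.card_le_card_of_injective g hinj).trans ?_⟩
    rw [Nat.card_prod, Nat.card_prod, Nat.card_fin, ← sq, pow_succ]
    exact Nat.mul_le_mul_right _ hcard

theorem boundedIndexSubgroups_finite_card (ι : Type*) [Fintype ι] (B : ℕ) :
    Finite (boundedIndexSubgroups (ι → ℤ) B) ∧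
      Nat.card (boundedIndexSubgroups (ι → ℤ) B) ≤ (B ^ 2) ^ Fintype.card ι := by
  obtain ⟨hfin, hcard⟩ := boundedIndexSubgroups_fin_finite_card (Fintype.card ι) B
  let e : (ι → ℤ) ≃+ (Fin (Fintype.card ι) → ℤ) :=
    (LinearEquiv.funCongrLeft ℤ ℤ (Fintype.equivFin ι).symm).toAddEquiv
  let g : boundedIndexSubgroups (ι → ℤ) B → boundedIndexSubgroups (Fin (Fintype.card ι) → ℤ) B :=
    fun K ↦ ⟨K.1.map (e : (ι → ℤ) →+ (Fin (Fintype.card ι) → ℤ)), by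
      change _ ≠ 0 ∧ _ ≤ B
      rw [AddSubgroup.index_map_equiv]
      exact K.2⟩
  have hg : Function.Injective g := fun K₁ K₂ h ↦
    Subtype.ext (AddSubgroup.map_injective e.injective (congrArg Subtype.val h))
  exact ⟨Finite.of_injective g hg, (Nat.card_le_card_of_injective g hg).trans hcard⟩

/-! ### Row lattices of integral endomorphisms -/

open Matrix in
theorem Matrix.index_range_mulVecLin {ι : Type*} [Fintype ι] [DecidableEq ι]
    {M : Matrix ι ι ℤ} (hM : M.det ≠ 0) :
    (LinearMap.range M.mulVecLin).toAddSubgroup.index = M.det.natAbs := by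
  have hinj : Function.Injective M.mulVecLin := by
    rw [coe_mulVecLin]
    exact Matrix.mulVec_injective_of_det_ne_zero hM
  have h := Submodule.natAbs_det_equiv (LinearMap.range M.mulVecLin)
    (LinearEquiv.ofInjective M.mulVecLin hinj)
  have hcomp : (LinearMap.range M.mulVecLin).subtype ∘ₗ AddMonoidHom.toIntLinearMap
      ((LinearEquiv.ofInjective M.mulVecLin hinj : (ι → ℤ) ≃ₗ[ℤ] _) :
        (ι → ℤ) →+ LinearMap.range M.mulVecLin) = Matrix.toLin' M := by
    ext; rfl
  rw [hcomp, LinearMap.det_toLin'] at h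
  exact h.symm

section RowLattice

variable {R L ι : Type*} [CommRing R] [AddCommGroup L] [Module R L] [Fintype ι] [DecidableEq ι]

/-- The matrix of an endomorphism with respect to a `ℤ`-basis. -/
noncomputable abbrev intMatrix (b : Module.Basis ι ℤ L) (T : L →ₗ[R] L) : Matrix ι ι ℤ :=
  LinearMap.toMatrix b b (T.restrictScalars ℤ)

/-- The lattice spanned by the rows of the matrix of an endomorphism. -/
noncomputable def rowLattice (b : Module.Basis ι ℤ L) (T : L →ₗ[R] L) : AddSubgroup (ι → ℤ) :=
  (LinearMap.range (intMatrix b T).transpose.mulVecLin).toAddSubgroup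

theorem rowLattice_mem_boundedIndexSubgroups {b : Module.Basis ι ℤ L} {T : L →ₗ[R] L} {B : ℕ}
    (h0 : (intMatrix b T).det ≠ 0) (hB : (intMatrix b T).det.natAbs ≤ B) :
    rowLattice b T ∈ boundedIndexSubgroups (ι → ℤ) B := by
  change _ ≠ 0 ∧ _ ≤ B
  rw [rowLattice, Matrix.index_range_mulVecLin (by rwa [Matrix.det_transpose]),
    Matrix.det_transpose]
  exact ⟨Int.natAbs_ne_zero.mpr h0, hB⟩

theorem exists_mul_of_rowLattice_le {b : Module.Basis ι ℤ L} {T T' : L →ₗ[R] L}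
    (h : rowLattice b T' ≤ rowLattice b T) :
    ∃ U : Matrix ι ι ℤ, intMatrix b T' = U * intMatrix b T := by
  have hex : ∀ i, ∃ u : ι → ℤ, (intMatrix b T).transpose.mulVec u = (intMatrix b T') i := by
    intro i
    have : (intMatrix b T') i ∈ rowLattice b T := h ⟨Pi.single i 1, by simp; rfl⟩
    exact this
  choose u hu using hex
  refine ⟨Matrix.of u, ?_⟩
  ext i j
  rw [← hu i, Matrix.mul_apply']
  exact dotProduct_comm _ _

theorem exists_apply_eq_det_smul (b : Module.Basis ι ℤ L) (T : L →ₗ[R] L) (x : L) :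
    ∃ y, T y = (intMatrix b T).det • x := by
  refine ⟨Matrix.toLin b b (intMatrix b T).adjugate x, ?_⟩
  have h : (T.restrictScalars ℤ) ∘ₗ Matrix.toLin b b (intMatrix b T).adjugate =
      (intMatrix b T).det • LinearMap.id := by
    rw [← Matrix.toLin_toMatrix b b (T.restrictScalars ℤ), ← Matrix.toLin_mul,
      Matrix.mul_adjugate, map_smul, Matrix.toLin_one]
  exact LinearMap.congr_fun h x

/-- Each matrix is an integral left multiple of the other, so the multiplier U is unimodular and
satisfies T' = U T. Thus U is R-linear on the image of T; as this image contains (det T) L and L is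
torsion-free over ℤ, U is R-linear on all of L. -/
theorem exists_linearEquiv_of_rowLattice_eq {b : Module.Basis ι ℤ L} {T T' : L →ₗ[R] L}
    (h0 : (intMatrix b T).det ≠ 0) (h : rowLattice b T = rowLattice b T') :
    ∃ γ : L ≃ₗ[R] L, (∀ x, γ (T x) = T' x) ∧
      (intMatrix b T').det.natAbs = (intMatrix b T).det.natAbs := by
  obtain ⟨U, hU⟩ := exists_mul_of_rowLattice_le h.ge
  obtain ⟨U', hU'⟩ := exists_mul_of_rowLattice_le h.le
  have hUU : U' * U = 1 := by
    have h1 : (U' * U) * intMatrix b T = 1 * intMatrix b T := by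
      rw [Matrix.mul_assoc, ← hU, ← hU', Matrix.one_mul]
    -- The adjugate turns the matrix on the right into its nonzero determinant, which cancels over
    -- ℤ.
    have h2 := congrArg (· * (intMatrix b T).adjugate) h1
    simp only [Matrix.mul_assoc, Matrix.mul_adjugate, Matrix.mul_smul, Matrix.mul_one] at h2
    exact smul_right_injective _ h0 h2
  have hg : ∀ x, Matrix.toLin b b U (T x) = T' x := fun x ↦ by
    have : Matrix.toLin b b U ∘ₗ (T.restrictScalars ℤ) = T'.restrictScalars ℤ := by
      rw [← Matrix.toLin_toMatrix b b (T.restrictScalars ℤ), ← Matrix.toLin_mul, ← hU,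
        Matrix.toLin_toMatrix]
    exact LinearMap.congr_fun this x
  have : Module.Free ℤ L := Module.Free.of_basis b
  let γ : L →ₗ[R] L :=
    { toFun := Matrix.toLin b b U
      map_add' := map_add _
      map_smul' := fun a y ↦ by
        obtain ⟨z, hz⟩ := exists_apply_eq_det_smul b T y
        refine smul_right_injective L h0 ?_
        dsimp only [RingHom.id_apply]
        rw [← map_smul, smul_comm _ a y, ← hz, ← map_smul, hg, map_smul, ← hg, hz, map_smul,
          smul_comm] }
  have hl : Function.LeftInverse (Matrix.toLin b b U') γ := fun x ↦ by
    change (Matrix.toLin b b U' ∘ₗ Matrix.toLin b b U) x = x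
    rw [← Matrix.toLin_mul, hUU, Matrix.toLin_one, LinearMap.id_apply]
  have hr : Function.RightInverse (Matrix.toLin b b U') γ := fun x ↦ by
    change (Matrix.toLin b b U ∘ₗ Matrix.toLin b b U') x = x
    rw [← Matrix.toLin_mul, mul_eq_one_comm.mp hUU, Matrix.toLin_one, LinearMap.id_apply]
  refine ⟨LinearEquiv.ofBijective γ ⟨hl.injective, hr.surjective⟩, hg, ?_⟩
  have hunit : IsUnit U.det := by
    rw [isUnit_iff_exists_inv]
    exact ⟨U'.det, by rw [← Matrix.det_mul, mul_eq_one_comm.mp hUU, Matrix.det_one]⟩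
  rw [hU, Matrix.det_mul, Int.natAbs_mul, Int.isUnit_iff_natAbs_eq.mp hunit, one_mul]

end RowLattice

/-! ### Counting lattice points -/

section Points

variable {F : Type*} [Field F] [NumberField F]

/-- The norm of a nonzero integer is a nonzero rational integer, but it is also the product of the
conjugates. -/
theorem NumberField.RingOfIntegers.eq_zero_of_norm_lt_one {a : 𝓞 F}
    (h : ∀ σ : F →+* ℂ, ‖σ a‖ < 1) : a = 0 := by
  by_contra ha
  have hn : (1 : ℝ) ≤ |(Algebra.norm ℚ (a : F) : ℝ)| := by
    have : Algebra.norm ℤ a ≠ 0 := Algebra.norm_ne_zero_iff.mpr ha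
    rw [← Algebra.coe_norm_int]
    exact_mod_cast Int.one_le_abs this
  have hp := congrArg (‖·‖) (Algebra.norm_eq_prod_embeddings ℚ ℂ (a : F))
  simp only [eq_ratCast, Complex.norm_ratCast, norm_prod] at hp
  rw [hp] at hn
  refine absurd hn (not_le.mpr ?_)
  have : Nonempty (F →ₐ[ℚ] ℂ) := (RingHom.equivRatAlgHom F ℂ).symm.nonempty
  calc ∏ σ : F →ₐ[ℚ] ℂ, ‖σ a‖ < ∏ _σ : F →ₐ[ℚ] ℂ, (1 : ℝ) :=
        Finset.prod_lt_prod_of_nonempty (fun σ _ ↦ by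
          rw [norm_pos_iff]
          exact (map_ne_zero σ).mpr (by simpa using ha)) (fun σ _ ↦ h σ) Finset.univ_nonempty
    _ = 1 := by simp

/-- The cell of side `1 / 2` that contains a complex number. -/
noncomputable def cell (z : ℂ) : ℤ × ℤ := (⌊2 * z.re⌋, ⌊2 * z.im⌋)

/-- A square of side 1/2 has diameter √2/2 < 1. -/
theorem norm_sub_lt_one_of_cell_eq {z w : ℂ} (h : cell z = cell w) : ‖z - w‖ < 1 := by
  simp only [cell, Prod.mk.injEq] at h
  have h1 := abs_lt.mp (Int.abs_sub_lt_one_of_floor_eq_floor h.1)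
  have h2 := abs_lt.mp (Int.abs_sub_lt_one_of_floor_eq_floor h.2)
  rw [← sq_lt_one_iff₀ (norm_nonneg _), ← Complex.normSq_eq_norm_sq, Complex.normSq_apply]
  simp only [Complex.sub_re, Complex.sub_im]
  nlinarith [h1.1, h1.2, h2.1, h2.2]

theorem cell_mem {z : ℂ} {Q : ℕ} (h : ‖z‖ ≤ Q) :
    cell z ∈ Finset.Icc (-(2 * Q : ℤ)) (2 * Q) ×ˢ Finset.Icc (-(2 * Q : ℤ)) (2 * Q) := by
  have aux : ∀ t : ℝ, |t| ≤ Q → ⌊2 * t⌋ ∈ Finset.Icc (-(2 * Q : ℤ)) (2 * Q) := fun t ht ↦ by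
    rw [abs_le] at ht
    rw [Finset.mem_Icc]
    constructor
    · rw [Int.le_floor]; push_cast; linarith
    · have : (⌊2 * t⌋ : ℝ) ≤ ((2 * Q : ℤ) : ℝ) := by
        push_cast; linarith [Int.floor_le (2 * t)]
      exact_mod_cast this
  rw [Finset.mem_product]
  exact ⟨aux _ ((Complex.abs_re_le_norm z).trans h), aux _ ((Complex.abs_im_le_norm z).trans h)⟩

variable {L ι : Type*} [AddCommGroup L] [Module (𝓞 F) L] [Fintype ι]

/-- The lattice vectors `x` such that `δ x = T y` with a vector `y` of bounded coordinates. -/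
def boundedPoints (f : Module.Basis ι (𝓞 F) L) (T : L →ₗ[𝓞 F] L) (δ Q : ℕ) : Set L :=
  {x | ∃ y, T y = δ • x ∧ ∀ (σ : F →+* ℂ) (i : ι), ‖σ (f.repr y i)‖ ≤ Q}

/-- The cells of all conjugates of all coordinates determine y, since two integers whose conjugates
share cells are equal. Then y determines x because L is torsion-free. Each conjugate has (4Q + 1) ^
2 possible cells. -/
theorem boundedPoints_finite_card (f : Module.Basis ι (𝓞 F) L) (T : L →ₗ[𝓞 F] L) {δ : ℕ}
    (hδ : δ ≠ 0) (Q : ℕ) :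
    Finite (boundedPoints f T δ Q) ∧ Nat.card (boundedPoints f T δ Q) ≤
      (4 * Q + 1) ^ (2 * (Fintype.card ι * Module.finrank ℚ F)) := by
  classical
  choose y hy hyQ using fun x : boundedPoints f T δ Q ↦ x.2
  let C : Finset (ℤ × ℤ) := Finset.Icc (-(2 * Q : ℤ)) (2 * Q) ×ˢ Finset.Icc (-(2 * Q : ℤ)) (2 * Q)
  let g : boundedPoints f T δ Q → (ι × (F →+* ℂ) → C) := fun x j ↦
    ⟨cell (j.2 (f.repr (y x) j.1)), cell_mem (hyQ x j.2 j.1)⟩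
  have hg : Function.Injective g := by
    intro x x' h
    have hyy : y x = y x' := by
      refine f.repr.injective (Finsupp.ext fun i ↦ sub_eq_zero.mp ?_)
      refine NumberField.RingOfIntegers.eq_zero_of_norm_lt_one fun σ ↦ ?_
      have := norm_sub_lt_one_of_cell_eq (congrArg Subtype.val (congrFun h (i, σ)))
      simpa using this
    have h1 : δ • (x : L) = δ • (x' : L) := by rw [← hy, ← hy, hyy]
    have : Module.Free (𝓞 F) L := Module.Free.of_basis f
    have hδ' : (δ : 𝓞 F) ≠ 0 := by exact_mod_cast hδ
    simp only [← Nat.cast_smul_eq_nsmul (𝓞 F)] at h1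
    exact Subtype.ext (smul_right_injective L hδ' h1)
  refine ⟨Finite.of_injective g hg, (Nat.card_le_card_of_injective g hg).trans ?_⟩
  have hC : Fintype.card C = (4 * Q + 1) ^ 2 := by
    rw [Fintype.card_coe, Finset.card_product, Int.card_Icc, sq]
    congr 1 <;> omega
  rw [Nat.card_eq_fintype_card, Fintype.card_fun, hC, Fintype.card_prod,
    NumberField.Embeddings.card, ← pow_mul]

end Points

/-! ### Hermitian forms and their Gram matrices -/

namespace HermitianLattice

section Comp

variable {F : Type*} [Field F] [NumberField F]

theorem comp_tmul (σ : F →+* ℂ) (a : F) (r : ℝ) : comp σ (a ⊗ₜ[ℚ] r) = σ a * r := by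
  simp [comp]

theorem comp_algebraMap (σ : F →+* ℂ) (a : F) : comp σ (algebraMap F (FR F) a) = σ a := by
  rw [Algebra.TensorProduct.algebraMap_apply, comp_tmul]
  simp

theorem comp_one_tmul (σ : F →+* ℂ) (r : ℝ) : comp σ ((1 : F) ⊗ₜ[ℚ] r) = r := by
  simp [comp_tmul]

open NumberField ComplexEmbedding in
theorem comp_conjugate (σ : F →+* ℂ) (z : FR F) :
    comp (conjugate σ) z = (starRingEnd ℂ) (comp σ z) := by
  induction z using TensorProduct.induction_on with
  | zero => simp
  | tmul a r => simp [comp_tmul]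
  | add x y hx hy => simp [hx, hy]

open NumberField ComplexEmbedding in
theorem comp_surjective {σ : F →+* ℂ} (hσ : ¬ IsReal σ) : Function.Surjective (comp σ) := by
  intro z
  obtain ⟨a, ha⟩ : ∃ a, (σ a).im ≠ 0 := by
    by_contra! h
    refine hσ (isReal_iff.mpr (RingHom.ext fun a ↦ ?_))
    rw [conjugate_coe_eq, Complex.conj_eq_iff_im]
    exact h a
  -- These are the real coordinates of z in the basis 1, σ(a) of ℂ.
  refine ⟨1 ⊗ₜ (z.re - z.im / (σ a).im * (σ a).re) + a ⊗ₜ (z.im / (σ a).im), ?_⟩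
  rw [map_add, comp_tmul, comp_tmul]
  apply Complex.ext
  · simp [-Complex.ofReal_sub, -Complex.ofReal_mul, -Complex.ofReal_div]
    ring
  · simp [-Complex.ofReal_sub, -Complex.ofReal_mul, -Complex.ofReal_div]
    field_simp

end Comp

section Lattice

variable {F : Type*} [Field F] [NumberField F] {L : Type*} [AddCommGroup L] [Module (𝓞 F) L]

theorem toV_smul (a : 𝓞 F) (x : L) : toV F L (a • x) = (a : F) • toV F L x := by
  rw [toV, toV, TensorProduct.smul_tmul', TensorProduct.tmul_smul, TensorProduct.smul_tmul',
    Algebra.smul_def, smul_eq_mul]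

theorem toV_sum {κ : Type*} (s : Finset κ) (v : κ → L) :
    toV F L (∑ k ∈ s, v k) = ∑ k ∈ s, toV F L (v k) :=
  TensorProduct.tmul_sum _ _ _

theorem toVR_smul (a : 𝓞 F) (x : L) :
    toVR F L (a • x) = algebraMap F (FR F) a • toVR F L x := by
  rw [algebraMap_smul]
  exact (congrArg _ (toV_smul a x)).trans (TensorProduct.tmul_smul (a : F) _ _)

theorem toVR_sum {κ : Type*} (s : Finset κ) (v : κ → L) :
    toVR F L (∑ k ∈ s, v k) = ∑ k ∈ s, toVR F L (v k) := by
  rw [toVR, toV_sum, TensorProduct.tmul_sum]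
  rfl

theorem toVR_zsmul (a : ℤ) (x : L) :
    toVR F L (a • x) = algebraMap F (FR F) a • toVR F L x := by
  have := toVR_smul (F := F) (a : 𝓞 F) x
  rw [Int.cast_smul_eq_zsmul] at this
  simpa using this

end Lattice

namespace PosDefHermitianForm

open Matrix

variable {F : Type*} [Field F] [NumberField F] {L : Type*} [AddCommGroup L] [Module (𝓞 F) L]
  (h : PosDefHermitianForm F L) {κ κ' : Type*}

theorem form_sum_left [Fintype κ] (a : κ → FR F) (v : κ → VR F L) (y : VR F L) :
    h.form (∑ k, a k • v k) y = ∑ k, a k * h.form (v k) y := by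
  let φ : VR F L →+ FR F := AddMonoidHom.mk' (fun x ↦ h.form x y) fun x x' ↦ h.add_left x x' y
  calc h.form (∑ k, a k • v k) y = φ (∑ k, a k • v k) := rfl
    _ = ∑ k, a k * h.form (v k) y := by
      rw [map_sum]
      exact Finset.sum_congr rfl fun k _ ↦ h.smul_left _ _ _

theorem comp_form_sum_right [Fintype κ] (σ : F →+* ℂ) (a : κ → FR F) (v : κ → VR F L) (x : VR F L) :
    comp σ (h.form x (∑ k, a k • v k)) =
      ∑ k, comp σ (h.form x (v k)) * star (comp σ (a k)) := by
  rw [h.conj_symm, form_sum_left, map_sum, map_sum]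
  refine Finset.sum_congr rfl fun k _ ↦ ?_
  rw [map_mul, map_mul, ← h.conj_symm, mul_comm]
  rfl

theorem comp_form_smul_right (σ : F →+* ℂ) (a : FR F) (x y : VR F L) :
    comp σ (h.form x (a • y)) = comp σ (h.form x y) * star (comp σ a) := by
  simpa using h.comp_form_sum_right σ (fun _ : Unit ↦ a) (fun _ ↦ y) x

/-- The Gram matrix of a family of vectors at an embedding. -/
noncomputable def gram (σ : F →+* ℂ) (v : κ → VR F L) : Matrix κ κ ℂ :=
  Matrix.of fun i j ↦ comp σ (h.form (v i) (v j))

theorem gram_linearCombination [Fintype κ] (σ : F →+* ℂ) (C : Matrix κ' κ (FR F)) (v : κ → VR F L) :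
    h.gram σ (fun i ↦ ∑ k, C i k • v k) =
      C.map (comp σ) * h.gram σ v * (C.map (comp σ))ᴴ := by
  ext i j
  simp only [gram, of_apply, comp_form_sum_right, form_sum_left, map_sum, map_mul, mul_apply,
    conjTranspose_apply, map_apply, Finset.sum_mul, Finset.mul_sum, mul_assoc]
  exact Finset.sum_comm

theorem gram_isHermitian (σ : F →+* ℂ) (v : κ → VR F L) : (h.gram σ v).IsHermitian := by
  ext i j
  simp [gram, conjTranspose_apply, h.conj_symm (v i) (v j)]

theorem star_dotProduct_gram [Fintype κ] (σ : F →+* ℂ) (v : κ → VR F L) (x : κ → ℂ) (a : κ → FR F)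
    (ha : ∀ k, comp σ (a k) = star (x k)) :
    star x ⬝ᵥ h.gram σ v *ᵥ x = comp σ (h.form (∑ k, a k • v k) (∑ k, a k • v k)) := by
  rw [comp_form_sum_right]
  simp only [form_sum_left, map_sum, map_mul, ha, star_star, dotProduct, mulVec, gram, of_apply,
    Finset.mul_sum, Finset.sum_mul, Pi.star_apply]
  rw [Finset.sum_comm]
  simp only [mul_assoc]

open scoped ComplexOrder in
theorem comp_form_self_nonneg (σ : F →+* ℂ) (x : VR F L) : 0 ≤ comp σ (h.form x x) := by
  rw [Complex.nonneg_iff]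
  exact ⟨h.nonneg x σ, (Complex.conj_eq_iff_im.mp (h.conj_symm x x σ).symm).symm⟩

open NumberField ComplexEmbedding in
open scoped ComplexOrder MatrixOrder Matrix.Norms.L2Operator in
-- At a non-real σ every complex coefficient lifts to F_ℝ, so positivity is inherited from h. At a
-- real σ only real coefficients lift; the Gram matrix is then real and semidefinite, hence of the
-- form BᵀB, which is also semidefinite over ℂ.
theorem gram_posSemidef [Fintype κ] (σ : F →+* ℂ) (v : κ → VR F L) : (h.gram σ v).PosSemidef := by
  classical
  by_cases hσ : IsReal σ
  · have hre : ∀ z : FR F, ((comp σ z).re : ℂ) = comp σ z := fun z ↦ by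
      rw [← Complex.conj_eq_iff_re, ← comp_conjugate, isReal_iff.mp hσ]
    let A : Matrix κ κ ℝ := (h.gram σ v).map Complex.re
    have hA : h.gram σ v = A.map Complex.ofReal := by
      ext i j
      exact (hre _).symm
    have hAps : A.PosSemidef := by
      refine .of_dotProduct_mulVec_nonneg ?_ fun x ↦ ?_
      · ext i j
        have := congrFun (congrFun (h.gram_isHermitian σ v) i) j
        simp only [A, conjTranspose_apply, map_apply, star_trivial] at this ⊢
        rw [← this]
        simp
      · have h1 := h.comp_form_self_nonneg σ (∑ k, ((1 : F) ⊗ₜ[ℚ] (x k) : FR F) • v k)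
        rw [← h.star_dotProduct_gram σ v (fun k ↦ (x k : ℂ)) _
          (fun k ↦ by rw [comp_one_tmul]; simp), hA] at h1
        have h2 : star (fun k ↦ (x k : ℂ)) ⬝ᵥ A.map Complex.ofReal *ᵥ (fun k ↦ (x k : ℂ)) =
            ((star x ⬝ᵥ A *ᵥ x : ℝ) : ℂ) := by
          simp [dotProduct, mulVec]
        rw [h2] at h1
        exact_mod_cast h1
    obtain ⟨B, hB⟩ := CStarAlgebra.nonneg_iff_eq_star_mul_self.mp hAps.nonneg
    have : A.map Complex.ofReal = (B.map Complex.ofReal)ᴴ * B.map Complex.ofReal := by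
      rw [hB]
      ext i j
      simp [mul_apply, star_eq_conjTranspose]
    rw [hA, this]
    exact posSemidef_conjTranspose_mul_self _
  · refine .of_dotProduct_mulVec_nonneg (h.gram_isHermitian σ v) fun x ↦ ?_
    choose a ha using fun k ↦ comp_surjective hσ (star (x k))
    rw [h.star_dotProduct_gram σ v x a ha]
    exact h.comp_form_self_nonneg σ _

/-- The Gram matrix of a family of vectors with respect to the trace form. -/
noncomputable def traceGram (v : κ → VR F L) : Matrix κ κ ℝ :=
  Matrix.of fun i j ↦ ∑ σ : F →+* ℂ, (comp σ (h.form (v i) (v j))).re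

open NumberField ComplexEmbedding in
-- Conjugate embeddings contribute conjugate values, so the imaginary parts cancel in the sum.
theorem map_traceGram (v : κ → VR F L) :
    (h.traceGram v).map Complex.ofReal = ∑ σ : F →+* ℂ, h.gram σ v := by
  ext i j
  rw [map_apply, traceGram, of_apply, Matrix.sum_apply]
  simp only [gram, of_apply]
  rw [← Complex.re_sum, ← Complex.conj_eq_iff_re, map_sum]
  refine Fintype.sum_equiv (involutive_conjugate F).toPerm _ _ fun σ ↦ ?_
  rw [← comp_conjugate]
  rfl

theorem q_nonneg (x : VR F L) : 0 ≤ h.q x := Finset.sum_nonneg fun σ _ ↦ h.nonneg x σ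

theorem dotProduct_traceGram [Fintype κ] (v : κ → VR F L) (x : κ → ℝ) :
    x ⬝ᵥ h.traceGram v *ᵥ x = h.q (∑ k, ((1 : F) ⊗ₜ[ℚ] (x k) : FR F) • v k) := by
  have h1 : ((x ⬝ᵥ h.traceGram v *ᵥ x : ℝ) : ℂ) =
      star (fun k ↦ (x k : ℂ)) ⬝ᵥ (h.traceGram v).map Complex.ofReal *ᵥ (fun k ↦ (x k : ℂ)) := by
    simp [dotProduct, mulVec]
  rw [← Complex.ofReal_re (x ⬝ᵥ h.traceGram v *ᵥ x), h1, map_traceGram, sum_mulVec, dotProduct_sum,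
    Complex.re_sum, q]
  refine Finset.sum_congr rfl fun σ _ ↦ ?_
  rw [h.star_dotProduct_gram σ v _ (fun k ↦ ((1 : F) ⊗ₜ[ℚ] (x k) : FR F))
    (fun k ↦ by rw [comp_one_tmul]; simp)]

theorem traceGram_posSemidef [Fintype κ] (v : κ → VR F L) : (h.traceGram v).PosSemidef := by
  refine .of_dotProduct_mulVec_nonneg ?_ fun x ↦ ?_
  · ext i j
    simp [traceGram, conjTranspose_apply, h.conj_symm (v i) (v j)]
  · rw [star_trivial, dotProduct_traceGram]
    exact h.q_nonneg _

theorem m_le (x : L) (hx : x ≠ 0) : h.m ≤ h.q (toVR F L x) := by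
  refine csInf_le ⟨0, ?_⟩ ⟨x, hx, rfl⟩
  rintro _ ⟨y, -, rfl⟩
  exact h.q_nonneg _

theorem one_le_det_traceGram [Fintype κ] [DecidableEq κ] (hm : h.m = 1) (b : Module.Basis κ ℤ L) :
    1 ≤ (h.traceGram fun k ↦ toVR F L (b k)).det * (Fintype.card κ : ℝ) ^ Fintype.card κ := by
  refine (h.traceGram_posSemidef _).one_le_det_mul_card_pow fun x hx ↦ ?_
  rw [dotProduct_traceGram]
  have hsum : ∑ k, ((1 : F) ⊗ₜ[ℚ] (x k : ℝ) : FR F) • toVR F L (b k) =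
      toVR F L (∑ k, x k • b k) := by
    rw [toVR_sum]
    refine Finset.sum_congr rfl fun k _ ↦ ?_
    rw [toVR_zsmul]
    congr 1
    rw [map_intCast, Algebra.TensorProduct.intCast_def']
  rw [hsum, ← hm]
  refine h.m_le _ fun h0 ↦ hx ?_
  exact funext (Fintype.linearIndependent_iff.mp b.linearIndependent x h0)

open scoped Kronecker in
-- Separates the scalars w from the vectors v. When w is an integral basis, the outer factors
-- contribute a power of the discriminant to the determinant.
theorem map_traceGram_smul [Fintype κ] [DecidableEq κ] [DecidableEq (F →+* ℂ)] (v : κ → VR F L) (w : (F →+* ℂ) → F) :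
    (h.traceGram fun p : κ × (F →+* ℂ) ↦ algebraMap F (FR F) (w p.2) • v p.1).map Complex.ofReal =
      ((1 : Matrix κ κ ℂ) ⊗ₖ Matrix.of fun τ σ : F →+* ℂ ↦ σ (w τ)) *
        blockDiagonal (fun σ ↦ h.gram σ v) *
        ((1 : Matrix κ κ ℂ) ⊗ₖ Matrix.of fun τ σ : F →+* ℂ ↦ σ (w τ))ᴴ := by
  rw [map_traceGram]
  ext ⟨i, τ⟩ ⟨j, τ'⟩
  simp only [Matrix.sum_apply, gram, of_apply, h.smul_left, map_mul, comp_form_smul_right,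
    comp_algebraMap, mul_apply, kroneckerMap_apply, one_apply, blockDiagonal_apply,
    Fintype.sum_prod_type, ite_mul, one_mul, zero_mul, mul_ite, mul_zero, conjTranspose_apply,
    apply_ite star, star_zero]
  simp [mul_assoc]

end PosDefHermitianForm

end HermitianLattice

/-! ### Determinant bounds for a frame of minimal vectors -/

namespace HermitianLattice

section LatticeBasis

variable (F : Type*) [Field F] [NumberField F] {L : Type*} [AddCommGroup L] [Module (𝓞 F) L]

/-- An integral basis indexed by the complex embeddings. -/
noncomputable def embBasis : Module.Basis (F →+* ℂ) ℤ (𝓞 F) :=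
  (NumberField.RingOfIntegers.basis F).reindex (NumberField.equivReindex F).symm

theorem norm_det_embBasis_sq [DecidableEq (F →+* ℂ)] :
    ‖(Matrix.of fun τ σ : F →+* ℂ ↦ σ (embBasis F τ)).det‖ ^ 2 =
      (NumberField.discr F).natAbs := by
  have : (Matrix.of fun τ σ : F →+* ℂ ↦ σ (embBasis F τ)) = NumberField.basisMatrix F := by
    ext τ σ
    simp [embBasis, NumberField.integralBasis_apply]
  rw [this, ← norm_pow, ← NumberField.discr_eq_basisMatrix_det_sq, Complex.norm_intCast,
    ← Int.cast_abs, Int.abs_eq_natAbs, Int.cast_natCast]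

variable {F} {ι : Type*}

/-- The `ℤ`-basis of a lattice attached to an `𝓞 F`-basis. -/
noncomputable def intBasis (f : Module.Basis ι (𝓞 F) L) : Module.Basis (ι × (F →+* ℂ)) ℤ L :=
  ((embBasis F).smulTower f).reindex (Equiv.prodComm _ _)

theorem intBasis_apply (f : Module.Basis ι (𝓞 F) L) (p : ι × (F →+* ℂ)) :
    intBasis f p = embBasis F p.2 • f p.1 := by
  simp [intBasis]

end LatticeBasis

namespace PosDefHermitianForm

open Matrix

variable {F : Type*} [Field F] [NumberField F] {L : Type*} [AddCommGroup L] [Module (𝓞 F) L]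
  (h : PosDefHermitianForm F L) {ι : Type*} [Fintype ι] [DecidableEq ι]

/-- Both sides are the determinant of the trace form on the images of the ℤ-basis under T: once by
change of basis over ℤ, once by splitting over the embeddings. -/
theorem det_sq_mul_det_traceGram [DecidableEq (F →+* ℂ)] (f : Module.Basis ι (𝓞 F) L)
    (T : L →ₗ[𝓞 F] L) :
    (((intMatrix (intBasis f) T).det : ℝ) : ℂ) ^ 2 *
        (((h.traceGram fun p ↦ toVR F L (intBasis f p)).det : ℝ) : ℂ) =
      ((NumberField.discr F).natAbs : ℂ) ^ Fintype.card ι *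
        ∏ σ : F →+* ℂ, (h.gram σ fun i ↦ toVR F L (T (f i))).det := by
  set b := intBasis f with hb
  set E := intMatrix b T with hE
  have hT : (fun p ↦ toVR F L (T (b p))) = fun p : ι × (F →+* ℂ) ↦
      algebraMap F (FR F) (embBasis F p.2) • toVR F L (T (f p.1)) := by
    funext p
    rw [hb, intBasis_apply, map_smul, toVR_smul]
  have hTE : (fun p ↦ toVR F L (T (b p))) = fun p : ι × (F →+* ℂ) ↦
      ∑ k, (Matrix.of fun p k ↦ algebraMap F (FR F) ((E k p : ℤ) : F)) p k • toVR F L (b k) := by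
    funext p
    have : T (b p) = ∑ k, E k p • b k := by
      simp [hE, LinearMap.toMatrix_apply, b.sum_repr]
    rw [this, toVR_sum]
    simp only [of_apply, toVR_zsmul]
  have key : ((h.traceGram fun p ↦ toVR F L (T (b p))).map Complex.ofReal).det =
      (((E.det : ℤ) : ℝ) : ℂ) ^ 2 * (((h.traceGram fun p ↦ toVR F L (b p)).det : ℝ) : ℂ) := by
    have hmap : ∀ σ : F →+* ℂ,
        (Matrix.of fun p k ↦ algebraMap F (FR F) ((E k p : ℤ) : F)).map (comp σ) =
          Eᵀ.map (Int.castRingHom ℂ) := fun σ ↦ by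
      ext p k
      simp
    rw [map_traceGram, hTE]
    simp only [gram_linearCombination, hmap]
    rw [← Finset.sum_mul, ← Finset.mul_sum, ← map_traceGram, det_mul, det_mul]
    have h1 : (Eᵀ.map (Int.castRingHom ℂ)).det = (E.det : ℂ) := by
      rw [← RingHom.mapMatrix_apply, ← RingHom.map_det, det_transpose]
      rfl
    have h2 : ((h.traceGram fun p ↦ toVR F L (b p)).map Complex.ofReal).det =
        (((h.traceGram fun p ↦ toVR F L (b p)).det : ℝ) : ℂ) :=
      (RingHom.map_det Complex.ofRealHom _).symm
    rw [det_conjTranspose, h1, h2]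
    simp
    ring
  rw [← key, hT, h.map_traceGram_smul (fun i ↦ toVR F L (T (f i))) (fun τ ↦ (embBasis F τ : F)),
    det_mul, det_mul, det_conjTranspose, det_kronecker, det_blockDiagonal]
  simp only [det_one, one_pow, one_mul, star_pow]
  rw [mul_right_comm, ← mul_pow, Complex.star_def, Complex.mul_conj, Complex.normSq_eq_norm_sq,
    norm_det_embBasis_sq, Complex.ofReal_natCast]

open scoped ComplexOrder in
theorem gram_det_eq_re (σ : F →+* ℂ) (v : ι → VR F L) :
    (((h.gram σ v).det.re : ℝ) : ℂ) = (h.gram σ v).det :=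
  (Complex.eq_re_of_ofReal_le (r := 0) (by exact_mod_cast (h.gram_posSemidef σ v).det_nonneg)).symm

open scoped ComplexOrder in
theorem gram_det_re_nonneg (σ : F →+* ℂ) (v : ι → VR F L) : 0 ≤ (h.gram σ v).det.re :=
  (Complex.nonneg_iff.mp (h.gram_posSemidef σ v).det_nonneg).1

theorem gram_det_re_le_one (σ : F →+* ℂ) {v : ι → VR F L} (hv : ∀ i, h.q (v i) ≤ 1) :
    (h.gram σ v).det.re ≤ 1 :=
  (h.gram_posSemidef σ v).re_det_le_one fun i ↦
    (Finset.single_le_sum (f := fun σ : F →+* ℂ ↦ (comp σ (h.form (v i) (v i))).re)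
      (fun τ _ ↦ h.nonneg (v i) τ) (Finset.mem_univ σ)).trans (hv i)

/-- Minkowski's bound gives (det T)² ≤ Q ∏ G_σ with all G_σ in [0, 1]. Dropping every G_σ bounds the
index; dropping all but one and using (det T)² ≥ 1 bounds that one below. -/
theorem index_and_gram_bounds [DecidableEq (F →+* ℂ)] (hm : h.m = 1) (f : Module.Basis ι (𝓞 F) L)
    {T : L →ₗ[𝓞 F] L} (hT : ∀ i, h.q (toVR F L (T (f i))) ≤ 1)
    (h0 : (intMatrix (intBasis f) T).det ≠ 0) {n Q : ℕ}
    (hn : n = Fintype.card ι * Module.finrank ℚ F)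
    (hQ : Q = n ^ n * (NumberField.discr F).natAbs ^ Fintype.card ι) :
    (intMatrix (intBasis f) T).det.natAbs ^ 2 ≤ Q ∧
      ∀ σ, 1 ≤ Q * (h.gram σ fun i ↦ toVR F L (T (f i))).det.re := by
  have hcard : Fintype.card (ι × (F →+* ℂ)) = n := by
    rw [hn, Fintype.card_prod, NumberField.Embeddings.card]
  have h1 := h.one_le_det_traceGram hm (intBasis f)
  rw [hcard] at h1
  have h2 : ((intMatrix (intBasis f) T).det : ℝ) ^ 2 *
        (h.traceGram fun p ↦ toVR F L (intBasis f p)).det =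
      ((NumberField.discr F).natAbs : ℝ) ^ Fintype.card ι *
        ∏ σ : F →+* ℂ, (h.gram σ fun i ↦ toVR F L (T (f i))).det.re := by
    apply Complex.ofReal_injective
    have h3 := h.det_sq_mul_det_traceGram f T
    rw [Complex.ofReal_mul, Complex.ofReal_mul, Complex.ofReal_pow, Complex.ofReal_pow,
      Complex.ofReal_prod, Complex.ofReal_natCast, h3]
    simp only [h.gram_det_eq_re]
  set E := (intMatrix (intBasis f) T).det
  set A := (h.traceGram fun p ↦ toVR F L (intBasis f p)).det
  set G : (F →+* ℂ) → ℝ := fun σ ↦ (h.gram σ fun i ↦ toVR F L (T (f i))).det.re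
  have hG0 : ∀ σ, 0 ≤ G σ := fun σ ↦ h.gram_det_re_nonneg σ _
  have hG1 : ∀ σ, G σ ≤ 1 := fun σ ↦ h.gram_det_re_le_one σ hT
  have hprod : ((E ^ 2 : ℤ) : ℝ) * (A * (n : ℝ) ^ n) = Q * ∏ σ, G σ := by
    rw [← mul_assoc, Int.cast_pow, h2, hQ]
    push_cast
    ring
  have hE : ((E ^ 2 : ℤ) : ℝ) ≤ Q * ∏ σ, G σ := by
    rw [← hprod]
    exact le_mul_of_one_le_right (by positivity) h1
  constructor
  · have h3 : ((E ^ 2 : ℤ) : ℝ) ≤ Q := hE.trans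
      (mul_le_of_le_one_right (by positivity) (Finset.prod_le_one (fun σ _ ↦ hG0 σ) fun σ _ ↦ hG1 σ))
    have h4 : E ^ 2 ≤ (Q : ℤ) := by exact_mod_cast h3
    zify
    rwa [sq_abs]
  · intro σ
    have h3 : (1 : ℝ) ≤ ((E ^ 2 : ℤ) : ℝ) := by
      exact_mod_cast Int.add_one_le_iff.mpr (by positivity : 0 < E ^ 2)
    refine (h3.trans hE).trans (mul_le_mul_of_nonneg_left ?_ (by positivity))
    rw [← Finset.mul_prod_erase Finset.univ G (Finset.mem_univ σ)]
    exact mul_le_of_le_one_right (hG0 σ)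
      (Finset.prod_le_one (fun σ _ ↦ hG0 σ) fun σ _ ↦ hG1 σ)

/-- Cramer's rule: x is the combination of the e k = T (f k) with coefficients y_k / δ, so replacing
e i by x multiplies the Gram determinant by |σ(y_i) / δ|². The new determinant is still at most 1,
because x satisfies the same bound as the e k. -/
theorem norm_sq_mul_det_gram_le (f : Module.Basis ι (𝓞 F) L) {T : L →ₗ[𝓞 F] L}
    (hT : ∀ i, h.q (toVR F L (T (f i))) ≤ 1) {x y : L} {δ : ℕ} (hδ : δ ≠ 0)
    (hx : h.q (toVR F L x) ≤ 1) (hxy : T y = δ • x) (σ : F →+* ℂ) (i : ι) :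
    ‖σ (f.repr y i)‖ ^ 2 * (h.gram σ fun i ↦ toVR F L (T (f i))).det.re ≤ (δ : ℝ) ^ 2 := by
  set e : ι → VR F L := fun i ↦ toVR F L (T (f i)) with he
  let a : ι → FR F := fun k ↦ algebraMap F (FR F) ((δ : F)⁻¹ * f.repr y k)
  have hδF : (δ : F) ≠ 0 := Nat.cast_ne_zero.mpr hδ
  have hxa : toVR F L x = ∑ k, a k • e k := by
    have h1 : algebraMap F (FR F) (δ : F) • toVR F L x =
        ∑ k, algebraMap F (FR F) (f.repr y k) • e k := by
      have h2 : toVR F L (T y) = ∑ k, algebraMap F (FR F) (f.repr y k) • e k := by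
        conv_lhs => rw [← f.sum_repr y, map_sum, toVR_sum]
        refine Finset.sum_congr rfl fun k _ ↦ ?_
        rw [map_smul, toVR_smul]
      rw [← h2, hxy, ← natCast_zsmul, toVR_zsmul, Int.cast_natCast]
    simp only [a, map_mul, mul_smul, ← Finset.smul_sum]
    rw [← h1, smul_smul, ← map_mul, inv_mul_cancel₀ hδF, map_one, one_smul]
  -- This matrix performs the replacement of e i by x; its determinant is the coefficient a i.
  let C : Matrix ι ι (FR F) := (1 : Matrix ι ι (FR F)).updateRow i a
  have hupd : (fun j ↦ ∑ k, C j k • e k) = Function.update e i (toVR F L x) := by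
    funext j
    by_cases hj : j = i
    · subst hj
      simp [C, hxa]
    · simp [C, hj, Matrix.updateRow_ne, Matrix.one_apply]
  have hC : (C.map (comp σ)).det = (δ : ℂ)⁻¹ * σ (f.repr y i) := by
    have hmap : (C.map (comp σ)).det = comp σ C.det :=
      (AlgHom.map_det (comp σ) C).symm
    have hdet : C.det = a i := by
      rw [← Matrix.cramer_transpose_apply, Matrix.transpose_one, Matrix.cramer_one]
      rfl
    rw [hmap, hdet, comp_algebraMap]
    simp
  have hgram := congrArg Matrix.det (h.gram_linearCombination σ C e)
  rw [hupd, det_mul, det_mul, det_conjTranspose, mul_right_comm, Complex.star_def,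
    Complex.mul_conj, Complex.normSq_eq_norm_sq, hC] at hgram
  have hle := h.gram_det_re_le_one σ (v := Function.update e i (toVR F L x)) fun j ↦ by
    by_cases hj : j = i
    · subst hj; simpa using hx
    · simpa [hj] using hT j
  rw [hgram, Complex.re_ofReal_mul, norm_mul, norm_inv, Complex.norm_natCast, mul_pow, inv_pow,
    mul_assoc, inv_mul_le_iff₀ (by positivity), mul_one] at hle
  exact hle

theorem norm_repr_le [DecidableEq (F →+* ℂ)] (hm : h.m = 1) (f : Module.Basis ι (𝓞 F) L)
    {T : L →ₗ[𝓞 F] L} (hT : ∀ i, h.q (toVR F L (T (f i))) ≤ 1)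
    (h0 : (intMatrix (intBasis f) T).det ≠ 0) {n Q : ℕ}
    (hn : n = Fintype.card ι * Module.finrank ℚ F)
    (hQ : Q = n ^ n * (NumberField.discr F).natAbs ^ Fintype.card ι) {x y : L}
    (hx : h.q (toVR F L x) ≤ 1) (hxy : T y = (intMatrix (intBasis f) T).det.natAbs • x)
    (σ : F →+* ℂ) (i : ι) : ‖σ (f.repr y i)‖ ≤ Q := by
  obtain ⟨h1, h2⟩ := h.index_and_gram_bounds hm f hT h0 hn hQ
  have h3 := h.norm_sq_mul_det_gram_le f hT (Int.natAbs_ne_zero.mpr h0) hx hxy σ i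
  have h1' : (((intMatrix (intBasis f) T).det.natAbs : ℕ) : ℝ) ^ 2 ≤ Q := by exact_mod_cast h1
  refine (pow_le_pow_iff_left₀ (norm_nonneg _) (Nat.cast_nonneg Q) two_ne_zero).mp ?_
  calc ‖σ (f.repr y i)‖ ^ 2
      ≤ ‖σ (f.repr y i)‖ ^ 2 * (Q * (h.gram σ fun i ↦ toVR F L (T (f i))).det.re) :=
        le_mul_of_one_le_right (by positivity) (h2 σ)
    _ = Q * (‖σ (f.repr y i)‖ ^ 2 * (h.gram σ fun i ↦ toVR F L (T (f i))).det.re) := by ring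
    _ ≤ Q * Q := mul_le_mul_of_nonneg_left (h3.trans h1') (Nat.cast_nonneg Q)
    _ = (Q : ℝ) ^ 2 := (sq _).symm

end PosDefHermitianForm

/-! ### Frames of minimal vectors and the numerical estimate -/

section Frames

variable {F : Type*} [Field F] [NumberField F] {L : Type*} [AddCommGroup L] [Module (𝓞 F) L]
  {ι : Type*}

/-- A kernel vector y of the matrix would give the F-linear relation ∑ y_i T (f i) = 0. -/
theorem intMatrix_det_ne_zero [Fintype ι] [DecidableEq ι] [DecidableEq (F →+* ℂ)] (f : Module.Basis ι (𝓞 F) L)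
    {T : L →ₗ[𝓞 F] L} (hT : LinearIndependent F fun i ↦ toV F L (T (f i))) :
    (intMatrix (intBasis f) T).det ≠ 0 := by
  intro h0
  obtain ⟨v, hv0, hv⟩ := Matrix.exists_mulVec_eq_zero_iff.mpr h0
  set b := intBasis f
  let y : L := b.equivFun.symm v
  have hTy : T y = 0 := by
    have := LinearMap.toMatrix_mulVec_repr b b (T.restrictScalars ℤ) y
    have hy : (b.repr y : ι × (F →+* ℂ) → ℤ) = v := b.equivFun.apply_symm_apply v
    rw [hy, hv] at this
    exact b.repr.map_eq_zero_iff.mp (Finsupp.ext fun k ↦ (congrFun this k).symm)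
  have hy0 : y = 0 := by
    refine f.repr.map_eq_zero_iff.mp (Finsupp.ext fun i ↦ ?_)
    have hsum : ∑ i, (f.repr y i : F) • toV F L (T (f i)) = 0 := by
      simp only [← toV_smul, ← map_smul, ← toV_sum, ← map_sum, f.sum_repr, hTy]
      exact TensorProduct.tmul_zero _ _
    have := Fintype.linearIndependent_iff.mp hT _ hsum i
    simpa using this
  exact hv0 (b.equivFun.symm.map_eq_zero_iff.mp hy0)

theorem exists_frame (f : Module.Basis ι (𝓞 F) L) {S : Set L}
    (hS : Submodule.span F (toV F L '' S) = ⊤) :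
    ∃ e : ι → L, (∀ i, e i ∈ S) ∧ LinearIndependent F fun i ↦ toV F L (e i) := by
  obtain ⟨B, hBS, hspan, hli⟩ := exists_linearIndependent F (toV F L '' S)
  let bB : Module.Basis B F (V F L) := Module.Basis.mk hli (by
    rw [Subtype.range_coe, hspan, hS])
  let c : ι ≃ B := (f.baseChange F).indexEquiv bB
  choose e heS he using fun i ↦ hBS (c i).2
  refine ⟨e, heS, ?_⟩
  simp only [he]
  exact hli.comp c c.injective

end Frames

theorem card_bound_le {N d D Q : ℕ} (hN : 1 ≤ N) (hd : 2 ≤ d) (hD : 1 ≤ D)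
    (hQ : Q = (N * d) ^ (N * d) * D ^ N) :
    Q ^ (N * d) * (4 * Q + 1) ^ (2 * (N * d)) ≤
      N ^ (3 * N ^ 2 * d ^ 2) * d ^ (5 * N ^ 3 * d ^ 4) * D ^ (9 * N ^ 3 * d ^ 3) := by
  have hQ1 : 1 ≤ Q := by rw [hQ]; exact Nat.one_le_iff_ne_zero.mpr (by positivity)
  -- The factor 25 comes from (4Q + 1)² ≤ 25 Q². It is absorbed into a power of d, which is possible
  -- since d ≥ 2.
  have h25 : 25 ^ (N * d) ≤ d ^ (5 * (N * d)) := by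
    rw [pow_mul d]
    refine Nat.pow_le_pow_left ?_ _
    calc 25 ≤ 2 ^ 5 := by norm_num
      _ ≤ d ^ 5 := Nat.pow_le_pow_left hd 5
  calc Q ^ (N * d) * (4 * Q + 1) ^ (2 * (N * d))
      ≤ Q ^ (N * d) * (5 * Q) ^ (2 * (N * d)) := by gcongr; omega
    _ = 25 ^ (N * d) * Q ^ (3 * (N * d)) := by
      rw [mul_pow 5, pow_mul 5 2]
      ring
    _ ≤ d ^ (5 * (N * d)) * Q ^ (3 * (N * d)) := Nat.mul_le_mul_right _ h25
    _ = N ^ (3 * N ^ 2 * d ^ 2) * d ^ (5 * (N * d) + 3 * N ^ 2 * d ^ 2) * D ^ (3 * N ^ 2 * d) := by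
      rw [hQ, mul_pow, mul_pow N, mul_pow, ← pow_mul, ← pow_mul, ← pow_mul, pow_add]
      ring_nf
    _ ≤ _ := by
      have hN2 : N ^ 2 ≤ N ^ 3 := Nat.pow_le_pow_right hN (by norm_num)
      gcongr ?_ * ?_ * ?_
      · exact le_rfl
      · refine Nat.pow_le_pow_right (by omega) ?_
        have h1 : N * d ≤ N ^ 2 * d ^ 2 := by nlinarith [Nat.mul_pos hN (by omega : 0 < d)]
        have h2 : N ^ 2 * d ^ 2 * 4 ≤ N ^ 3 * d ^ 4 := by
          calc N ^ 2 * d ^ 2 * 4 ≤ N ^ 3 * d ^ 2 * d ^ 2 := by gcongr; nlinarith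
            _ = _ := by ring
        nlinarith
      · refine Nat.pow_le_pow_right hD ?_
        have : d ≤ d ^ 3 := Nat.le_self_pow (by norm_num) d
        calc 3 * N ^ 2 * d ≤ 9 * N ^ 3 * d ^ 3 := by gcongr; norm_num

end HermitianLattice

/-! ### Construction of the finite set -/

theorem corollary5p2 (F : Type*) [Field F] [NumberField F] (hF : Module.finrank ℚ F ≠ 1)
    (L : Type*) [AddCommGroup L] [Module (𝓞 F) L] [Module.Free (𝓞 F) L] [Module.Finite (𝓞 F) L]
    (N d : ℕ) (hN : Module.finrank (𝓞 F) L = N) (hN5 : 5 ≤ N) (hd : Module.finrank ℚ F = d) :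
    ∃ Φ : Finset L,
      (∀ h : HermitianLattice.PosDefHermitianForm F L, h.IsWellRounded →
        ∃ γ : L ≃ₗ[𝓞 F] L, γ '' h.M ⊆ (Φ : Set L)) ∧
      Φ.card ≤ N ^ (3 * N ^ 2 * d ^ 2) * d ^ (5 * N ^ 3 * d ^ 4)
        * (NumberField.discr F).natAbs ^ (9 * N ^ 3 * d ^ 3) := by
  classical
  open HermitianLattice in
  let f : Module.Basis (Fin N) (𝓞 F) L := Module.finBasisOfFinrankEq (𝓞 F) L hN
  let b := intBasis f
  have hd2 : 2 ≤ d := by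
    have : 0 < Module.finrank ℚ F := Module.finrank_pos
    omega
  obtain ⟨Q, hQ⟩ : ∃ Q, Q = (N * d) ^ (N * d) * (NumberField.discr F).natAbs ^ N := ⟨_, rfl⟩
  have hn : N * d = Fintype.card (Fin N) * Module.finrank ℚ F := by rw [Fintype.card_fin, hd]
  have hQ' : Q = (N * d) ^ (N * d) * (NumberField.discr F).natAbs ^ Fintype.card (Fin N) := by
    rw [Fintype.card_fin, hQ]
  let good : AddSubgroup (Fin N × (F →+* ℂ) → ℤ) → (L →ₗ[𝓞 F] L) → Prop := fun K T ↦
    (intMatrix b T).det ≠ 0 ∧ rowLattice b T = K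
  -- The index is bounded by √Q since its square is at most Q; the exponent 2 in the subgroup count
  -- then turns this back into Q.
  obtain ⟨hSfin, hScard⟩ := boundedIndexSubgroups_finite_card (Fin N × (F →+* ℂ)) (Nat.sqrt Q)
  let S := boundedIndexSubgroups (Fin N × (F →+* ℂ) → ℤ) (Nat.sqrt Q)
  have : Fintype S := Fintype.ofFinite S
  -- For each lattice K one representative T₀ is fixed. Any other T with row lattice K satisfies γ T
  -- = T₀, and γ carries the bounded points of T to those of T₀. A lattice that no T realizes gets
  -- the empty set.
  have hPt : ∀ K : S, ∃ P : Finset L, P.card ≤ (4 * Q + 1) ^ (2 * (N * d)) ∧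
      ∀ T, good K.1 T → ∃ γ : L ≃ₗ[𝓞 F] L,
        γ '' boundedPoints f T (intMatrix b T).det.natAbs Q ⊆ P := by
    intro K
    by_cases hK : ∃ T, good K.1 T
    · obtain ⟨T₀, hT₀, hKT₀⟩ := hK
      obtain ⟨hfin, hcard⟩ := boundedPoints_finite_card f T₀ (Int.natAbs_ne_zero.mpr hT₀) Q
      have hfin' : (boundedPoints f T₀ (intMatrix b T₀).det.natAbs Q).Finite := hfin
      refine ⟨hfin'.toFinset, ?_, fun T ⟨hT, hKT⟩ ↦ ?_⟩
      · rw [← Nat.card_eq_card_finite_toFinset, hn]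
        exact hcard
      · obtain ⟨γ, hγ, hdet⟩ := exists_linearEquiv_of_rowLattice_eq hT (hKT.trans hKT₀.symm)
        refine ⟨γ, ?_⟩
        rintro _ ⟨x, ⟨y, hxy, hy⟩, rfl⟩
        rw [Set.Finite.coe_toFinset]
        exact ⟨y, by rw [← hγ, hxy, hdet, map_nsmul], hy⟩
    · exact ⟨∅, by simp, fun T hT ↦ absurd ⟨T, hT⟩ hK⟩
  choose P hPcard hP using hPt
  refine ⟨Finset.univ.biUnion P, fun h hwr ↦ ?_, ?_⟩
  · obtain ⟨hm, hspan⟩ := hwr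
    obtain ⟨e, heM, heli⟩ := exists_frame f hspan
    let T : L →ₗ[𝓞 F] L := f.constr (𝓞 F) e
    have hTf : ∀ i, T (f i) = e i := fun i ↦ f.constr_basis _ _ _
    have hq : ∀ x ∈ h.M, h.q (toVR F L x) ≤ 1 := fun x hx ↦ (hx.trans hm).le
    have hTq : ∀ i, h.q (toVR F L (T (f i))) ≤ 1 := fun i ↦ hq _ (by rw [hTf]; exact heM i)
    have h0 : (intMatrix b T).det ≠ 0 := intMatrix_det_ne_zero f (by simpa only [hTf] using heli)
    have hidx := (h.index_and_gram_bounds hm f hTq h0 hn hQ').1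
    have hK : rowLattice b T ∈ S :=
      rowLattice_mem_boundedIndexSubgroups h0 (Nat.le_sqrt'.mpr hidx)
    obtain ⟨γ, hγ⟩ := hP ⟨_, hK⟩ T ⟨h0, rfl⟩
    refine ⟨γ, (Set.image_mono fun x hx ↦ ?_).trans (hγ.trans ?_)⟩
    · have hex : ∃ y, T y = (intMatrix b T).det.natAbs • x := by
        obtain ⟨y, hy⟩ := exists_apply_eq_det_smul b T x
        -- The adjugate produces y for det T rather than |det T|; a negative sign is absorbed into
        -- y.
        rcases Int.natAbs_eq (intMatrix b T).det with hs | hs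
        · exact ⟨y, by rw [hy, ← natCast_zsmul, ← hs]⟩
        · exact ⟨-y, by rw [map_neg, hy, ← natCast_zsmul, ← neg_smul, hs]; simp⟩
      obtain ⟨y, hy⟩ := hex
      exact ⟨y, hy, h.norm_repr_le hm f hTq h0 hn hQ' (hq x hx) hy⟩
    · exact_mod_cast Finset.subset_biUnion_of_mem P (Finset.mem_univ _)
  · refine (Finset.card_biUnion_le_card_mul _ _ _ fun K _ ↦ hPcard K).trans ?_
    have hD : 1 ≤ (NumberField.discr F).natAbs :=
      Nat.one_le_iff_ne_zero.mpr (Int.natAbs_ne_zero.mpr (NumberField.discr_ne_zero F))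
    refine le_trans (Nat.mul_le_mul_right _ ?_) (card_bound_le (by omega) hd2 hD hQ)
    rw [Finset.card_univ, ← Nat.card_eq_fintype_card]
    refine hScard.trans ?_
    rw [Fintype.card_prod, NumberField.Embeddings.card, ← hn]
    exact Nat.pow_le_pow_left (Nat.sqrt_le' Q) _
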